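/- Let $\Omega\subset\mathbb R^n$ be open (for instance a bounded Lipschitz domain), let $H$ be a real Hilbert space, and let $$J(u)=\tfrac12\|u\|_{L^2(\Omega)}^2+|u|_{BV},\qquad |u|_{BV}=\sup\Big\{\int_\Omega u\,\operatorname{div}\varphi\,dx:\ \varphi\in C^1_c(\Omega;\mathbb R^n),\ |\varphi|\le 1\Big\}\in[0,\infty],$$ for $u\in L^2(\Omega)$, with $\operatorname{dom}J=\{u: J(u)<\infty\}$. For $u\in\operatorname{dom}J$ the subdifferential is $$\partial J(u)=\{\xi\in L^2(\Omega):\ J(v)\ge J(u)+\langle\xi,v-u\rangle\ \text{for all } v\in L^2(\Omega)\},$$ and for $\xi,v\in L^2(\Omega)$ put $D_\xi(v,u)=J(v)-J(u)-\langle\xi,v-u\rangle$ (the Bregman distance). Let $\mathcal D\subset L^2(\Omega)$ be closed and convex, and let $F:\mathcal D\to H$ be Fréchet differentiable (relative to $\mathcal D$) with derivative $F'(u)\in\mathcal L(L^2(\Omega),H)$, $u\in\mathcal D$. Assume that 1. $F$ is weakly sequentially closed: if $u_m\in\mathcal D$, $u_m\rightharpoonup u$ in $L^2(\Omega)$ and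 $F(u_m)\rightharpoonup z$ in $H$, then $u\in\mathcal D$ and $F(u)=z$; 2. $F'$ is locally bounded on $\mathcal D$; 3. there are $\eta,\rho>0$, $y\in H$ and $\bar u\in\mathcal D\cap\operatorname{dom}J$ with $F(\bar u)=y$ such that $$\|F(v)-F(u)-F'(u)(v-u)\|\le\eta\,\|u-v\|_{L^2(\Omega)}\,\|F(u)-F(v)\|$$ for all $u,v\in\mathcal D$ with $\|u-\bar u\|_{L^2(\Omega)}<\rho$ and $\|v-\bar u\|_{L^2(\Omega)}<\rho$. Let $y^\delta\in H$ and $\alpha_j>0$ for $j=0,1,2,\dots$. Let $k\ge0$ and let $(u_0,\xi_0),\dots,(u_k,\xi_k)$ be iterates of the following method: $u_0\in\mathcal D\cap\operatorname{dom}J$, $\xi_0\in\partial J(u_0)$, and for $0\le j<k$ $$u_{j+1}\in\operatorname*{argmin}_{u\in\mathcal D}\Big\{\tfrac12\|F(u)-y^\delta\|^2+\alpha_j D_{\xi_j}(u,u_j)\Big\},\qquad \xi_{j+1}=\xi_j-\tfrac1{\alpha_j}F'(u_{j+1})^*\big(F(u_{j+1})-y^\delta\big).$$ Then the functional $u\mapsto\tfrac12\|F(u)-y^\delta\|^2+\alpha_kD_{\xi_k}(u,u_k)$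 has a minimizer over $\mathcal D$. Moreover, for every such minimizer $u_{k+1}$, one has $u_{k+1}\in\mathcal D\cap\operatorname{dom}J$, and $$\xi_{k+1}=\xi_k-\tfrac1{\alpha_k}F'(u_{k+1})^*\big(F(u_{k+1})-y^\delta\big)$$ is a subgradient at $u_{k+1}$ of $J$ regarded as a functional on $\mathcal D$, that is, $$J(v)\ge J(u_{k+1})+\langle\xi_{k+1},v-u_{k+1}\rangle\qquad\text{for all } v\in\mathcal D;$$ if $u_{k+1}$ is an interior point of $\mathcal D$ (in particular always when $\mathcal D=L^2(\Omega)$), then $\xi_{k+1}\in\partial J(u_{k+1})$. -/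

import Mathlib

open Filter Topology MeasureTheory

noncomputable section

namespace BregmanTikhonov

/-- The real Hilbert space `L²(Ω)` for `Ω ⊆ ℝⁿ`. -/
abbrev L2 {n : ℕ} (Ω : Set (EuclideanSpace ℝ (Fin n))) : Type :=
  Lp ℝ 2 ((volume : Measure (EuclideanSpace ℝ (Fin n))).restrict Ω)

/-- The divergence of a vector field on `ℝⁿ`. -/
def divergence {n : ℕ} (φ : EuclideanSpace ℝ (Fin n) → EuclideanSpace ℝ (Fin n))
    (x : EuclideanSpace ℝ (Fin n)) : ℝ :=
  ∑ i : Fin n, (fderiv ℝ φ x (EuclideanSpace.single i 1)) i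

/-- The test fields `φ ∈ C¹_c(Ω; ℝⁿ)` with `|φ(x)| ≤ 1` (Euclidean norm) for every `x`. -/
def testFields {n : ℕ} (Ω : Set (EuclideanSpace ℝ (Fin n))) :
    Set (EuclideanSpace ℝ (Fin n) → EuclideanSpace ℝ (Fin n)) :=
  {φ | ContDiff ℝ 1 φ ∧ HasCompactSupport φ ∧ tsupport φ ⊆ Ω ∧ ∀ x, ‖φ x‖ ≤ 1}

/-- The total variation (the `BV` seminorm)
`|u|_BV = sup { ∫_Ω u div φ | φ ∈ C¹_c(Ω; ℝⁿ), |φ| ≤ 1 } ∈ [0, ∞]`. -/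
def totalVariation {n : ℕ} (Ω : Set (EuclideanSpace ℝ (Fin n))) (u : L2 Ω) : EReal :=
  ⨆ φ ∈ testFields Ω, ((∫ x in Ω, u x * divergence φ x : ℝ) : EReal)

/-- The regularization functional `J(u) = ½ ‖u‖²_{L²} + |u|_BV`, with values in `[0, ∞]`. -/
def J {n : ℕ} (Ω : Set (EuclideanSpace ℝ (Fin n))) (u : L2 Ω) : EReal :=
  ((1 / 2 * ‖u‖ ^ 2 : ℝ) : EReal) + totalVariation Ω u

/-- The effective domain of `J`. -/
def domJ {n : ℕ} (Ω : Set (EuclideanSpace ℝ (Fin n))) : Set (L2 Ω) :=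
  {u | J Ω u < ⊤}

/-- The subdifferential at `u` of `J` regarded as a functional on the set `C`, that is, the
subdifferential of `J` plus the indicator function of `C`
(`L²` is identified with its dual). -/
def subdifferentialOn {n : ℕ} (Ω : Set (EuclideanSpace ℝ (Fin n))) (C : Set (L2 Ω)) (u : L2 Ω) :
    Set (L2 Ω) :=
  {ξ | u ∈ C ∧ u ∈ domJ Ω ∧ ∀ v ∈ C, J Ω u + ((inner ℝ ξ (v - u) : ℝ) : EReal) ≤ J Ω v}

/-- The subdifferential `∂J(u)` of `J` on the whole space `L²(Ω)`. -/
def subdifferential {n : ℕ} (Ω : Set (EuclideanSpace ℝ (Fin n))) (u : L2 Ω) : Set (L2 Ω) :=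
  {ξ | u ∈ domJ Ω ∧ ∀ v : L2 Ω, J Ω u + ((inner ℝ ξ (v - u) : ℝ) : EReal) ≤ J Ω v}

/-- The Bregman distance `D_ξ(v, u) = J(v) - J(u) - ⟨ξ, v - u⟩`, for `u ∈ dom J`. -/
def bregman {n : ℕ} (Ω : Set (EuclideanSpace ℝ (Fin n))) (ξ v u : L2 Ω) : EReal :=
  J Ω v - J Ω u - ((inner ℝ ξ (v - u) : ℝ) : EReal)

/-- Weak convergence of a sequence in a real normed space. -/
def WeaklyTendsto {E : Type*} [NormedAddCommGroup E] [NormedSpace ℝ E] (x : ℕ → E) (a : E) :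
    Prop :=
  ∀ f : E →L[ℝ] ℝ, Tendsto (fun m => f (x m)) atTop (𝓝 (f a))

/-- The operator `F : D ⊆ X → H` (only its values on `D` matter) is weakly sequentially closed. -/
def WeaklySeqClosed {X H : Type*} [NormedAddCommGroup X] [NormedSpace ℝ X]
    [NormedAddCommGroup H] [NormedSpace ℝ H] (D : Set X) (F : X → H) : Prop :=
  ∀ (x : ℕ → X) (a : X) (z : H), (∀ m, x m ∈ D) → WeaklyTendsto x a →
    WeaklyTendsto (fun m => F (x m)) z → a ∈ D ∧ F a = z

variable {n : ℕ} {H : Type*} [NormedAddCommGroup H] [InnerProductSpace ℝ H]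

/-- The assumptions on the forward operator `F : D ⊆ L²(Ω) → H`, its Fréchet derivative `F'`, the
exact data `y` and the solution `ubar`. -/
structure OperatorAssumption (Ω : Set (EuclideanSpace ℝ (Fin n))) (D : Set (L2 Ω))
    (F : L2 Ω → H) (F' : L2 Ω → (L2 Ω →L[ℝ] H)) (y : H) (ubar : L2 Ω) (η ρ : ℝ) : Prop where
  closed_domain : IsClosed D
  convex_domain : Convex ℝ D
  differentiable : ∀ u ∈ D, HasFDerivWithinAt F (F' u) D u
  weaklySeqClosed : WeaklySeqClosed D F
  locallyBounded : ∀ u ∈ D, ∃ M : ℝ, ∀ᶠ v in 𝓝[D] u, ‖F' v‖ ≤ M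
  eta_pos : 0 < η
  rho_pos : 0 < ρ
  ubar_mem : ubar ∈ D
  ubar_solves : F ubar = y
  ubar_domJ : ubar ∈ domJ Ω
  nonlinearity : ∀ u ∈ Metric.ball ubar ρ ∩ D, ∀ v ∈ Metric.ball ubar ρ ∩ D,
    ‖F v - F u - F' u (v - u)‖ ≤ η * ‖u - v‖ * ‖F u - F v‖

/-- The functional `w ↦ ½ ‖F(w) - y^δ‖² + a D_ξ(w, u)` minimized in one step. -/
def stepFunctional (Ω : Set (EuclideanSpace ℝ (Fin n))) (F : L2 Ω → H) (yδ : H) (a : ℝ)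
    (u ξ w : L2 Ω) : EReal :=
  ((1 / 2 * ‖F w - yδ‖ ^ 2 : ℝ) : EReal) + (a : EReal) * bregman Ω ξ w u

/-- `w` is a minimizer over `D` of the functional of one step. -/
def IsStepMinimizer (Ω : Set (EuclideanSpace ℝ (Fin n))) (D : Set (L2 Ω)) (F : L2 Ω → H)
    (yδ : H) (a : ℝ) (u ξ w : L2 Ω) : Prop :=
  w ∈ D ∧ IsMinOn (stepFunctional Ω F yδ a u ξ) D w

/-- The update `ξ - (1/a) F'(w)* (F(w) - y^δ)`, with the Hilbert space adjoint. -/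
def subgradientUpdate [CompleteSpace H] (Ω : Set (EuclideanSpace ℝ (Fin n))) (F : L2 Ω → H)
    (F' : L2 Ω → (L2 Ω →L[ℝ] H)) (yδ : H) (a : ℝ) (ξ w : L2 Ω) : L2 Ω :=
  ξ - (1 / a) • ContinuousLinearMap.adjoint (F' w) (F w - yδ)

/-- `(u 0, ξ 0), …, (u k, ξ k)` are iterates of the Tikhonov method with Bregman distance. -/
structure AreIterates [CompleteSpace H] (Ω : Set (EuclideanSpace ℝ (Fin n))) (D : Set (L2 Ω))
    (F : L2 Ω → H) (F' : L2 Ω → (L2 Ω →L[ℝ] H)) (yδ : H) (α : ℕ → ℝ) (u ξ : ℕ → L2 Ω) (k : ℕ) :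
    Prop where
  init_mem : u 0 ∈ D ∩ domJ Ω
  init_subgradient : ξ 0 ∈ subdifferential Ω (u 0)
  minimizer : ∀ j < k, IsStepMinimizer Ω D F yδ (α j) (u j) (ξ j) (u (j + 1))
  update : ∀ j < k, ξ (j + 1) = subgradientUpdate Ω F F' yδ (α j) (ξ j) (u (j + 1))

end BregmanTikhonov

end

/-!
The subgradient property is the first order optimality condition for the step functional
`T w = ½ ‖F w - y^δ‖² + a D_ξ(w, u)`; the existence of a minimizer is the direct method.

*Structure of `J`.* Testing with `φ = 0` shows `J u ≥ ½ ‖u‖²`, and for each test field `φ` the map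
`u ↦ ∫_Ω u div φ` is a continuous linear functional on `L²(Ω)`, because `div φ` is continuous with
compact support. Hence `J u ≤ c` for a real `c` if and only if `½ ‖u‖² + ∫_Ω u div φ ≤ c` for all
`φ` (`J_le_coe_iff`). Convexity (`J_segment_le`) and all lower semicontinuity arguments are read
off from this description.

*Existence* (`exists_isStepMinimizer`). As `J w - ⟨ξ, w⟩ ≥ ½ ‖w - ξ‖² - ½ ‖ξ‖²`, the functional `T`
is bounded below, and along a minimizing sequence both `w_m` and `F w_m` are bounded. Bounded
sequences in a Hilbert space have weakly convergent subsequences (`exists_weaklyTendsto_subseq`,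
which reduces to the sequential Banach-Alaoglu theorem on the separable closed span of the
sequence). The weak sequential closedness of `F` identifies the limit of `F w_m` with `F w`, and
weak lower semicontinuity of the norms and of `J` shows that `w` is a minimizer.

*Optimality* (`subgradientUpdate_mem_subdifferentialOn`). Let `w` be a minimizer and
`v ∈ D ∩ dom J`. On the segment `w + t (v - w)` the convexity of `J` gives
`½ ‖F (w + t (v - w)) - y^δ‖² + t a (J v - J w - ⟨ξ, v - w⟩) ≥ ½ ‖F w - y^δ‖²`, with equality at
`t = 0`, so that the right derivative at `0` of the left side is nonnegative. This is the
subgradient inequality for the update. At an interior point of `D` the inequality on `D` extends to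
all of `L²(Ω)` by convexity (`mem_subdifferential_of_mem_interior`).

Both parts start from `u ∈ D ∩ dom J`, which holds for every iterate by induction: a minimizer has a
finite value of `T`, since it competes with `u` (`AreIterates.mem`).
-/

namespace BregmanTikhonov

/-! ### Weak convergence in Hilbert spaces -/

section Weak

variable {E : Type*} [NormedAddCommGroup E] [InnerProductSpace ℝ E]

theorem WeaklyTendsto.comp {x : ℕ → E} {a : E} (h : WeaklyTendsto x a) {φ : ℕ → ℕ}
    (hφ : StrictMono φ) : WeaklyTendsto (fun m => x (φ m)) a :=
  fun f => (h f).comp hφ.tendsto_atTop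

/-- Bounded sequences in a Hilbert space, separable or not, have weakly convergent
subsequences. -/
theorem exists_weaklyTendsto_subseq [CompleteSpace E] (x : ℕ → E) (C : ℝ)
    (hx : ∀ m, ‖x m‖ ≤ C) :
    ∃ (a : E) (φ : ℕ → ℕ), StrictMono φ ∧ WeaklyTendsto (fun m => x (φ m)) a := by
  -- The closed span `S` of the sequence is separable, and functionals on `E` restrict to `S`.
  let S : Submodule ℝ E := (Submodule.span ℝ (Set.range x)).topologicalClosure
  have hmem : ∀ m, x m ∈ S := fun m =>
    Submodule.le_topologicalClosure _ (Submodule.subset_span ⟨m, rfl⟩)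
  have hsep : TopologicalSpace.IsSeparable (S : Set E) := by
    rw [Submodule.topologicalClosure_coe]
    exact ((Set.countable_range x).isSeparable.span (R := ℝ)).closure
  have : TopologicalSpace.SeparableSpace S := hsep.separableSpace
  have : CompleteSpace S :=
    (Submodule.isClosed_topologicalClosure _).completeSpace_coe
  let xs : ℕ → S := fun m => ⟨x m, hmem m⟩
  let d : ℕ → WeakDual ℝ S := fun m =>
    StrongDual.toWeakDual (InnerProductSpace.toDual ℝ S (xs m))
  obtain ⟨f, -, φ, hφ, hlim⟩ := WeakDual.isSeqCompact_closedBall ℝ S 0 C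
    (x := d) (fun m => by
      simp only [Set.mem_preimage, mem_closedBall_zero_iff]
      change ‖InnerProductSpace.toDual ℝ S (xs m)‖ ≤ C
      rw [LinearIsometryEquiv.norm_map]
      exact hx m)
  let a : S := (InnerProductSpace.toDual ℝ S).symm (WeakDual.toStrongDual f)
  refine ⟨a, φ, hφ, fun g => ?_⟩
  let b : S := (InnerProductSpace.toDual ℝ S).symm (g.comp S.subtypeL)
  have hb : ∀ z : S, g z = inner ℝ z b := fun z => by
    rw [real_inner_comm, InnerProductSpace.toDual_symm_apply]
    rfl
  have hfb : f b = inner ℝ a b := by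
    rw [InnerProductSpace.toDual_symm_apply]
    rfl
  rw [hb a, ← hfb]
  have h := ((WeakDual.eval_continuous b).tendsto f).comp hlim
  refine h.congr fun m => ?_
  exact (hb (xs (φ m))).symm

/-- The affine minorant `½ ‖a - z‖² + ⟨a - z, x - a⟩` of `½ ‖x - z‖²`, which touches at `x = a`. -/
theorem half_norm_sub_sq_ge (x a z : E) :
    1 / 2 * ‖a - z‖ ^ 2 + inner ℝ (a - z) (x - a) ≤ 1 / 2 * ‖x - z‖ ^ 2 := by
  have h : x - z = (a - z) + (x - a) := by abel
  have h2 := norm_add_sq_real (a - z) (x - a)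
  rw [← h] at h2
  nlinarith [sq_nonneg ‖x - a‖]

theorem WeaklyTendsto.inner_sub {x : ℕ → E} {a : E} (h : WeaklyTendsto x a) (b : E) :
    Tendsto (fun m => inner ℝ b (x m - a)) atTop (𝓝 0) := by
  have h1 := (h (innerSL ℝ b)).sub_const (innerSL ℝ b a)
  simpa [inner_sub_right] using h1

end Weak

variable {n : ℕ} {Ω : Set (EuclideanSpace ℝ (Fin n))}

/-! ### The functional `J` -/

theorem continuous_divergence {φ : EuclideanSpace ℝ (Fin n) → EuclideanSpace ℝ (Fin n)}
    (hφ : ContDiff ℝ 1 φ) : Continuous (divergence φ) := by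
  have h := hφ.continuous_fderiv one_ne_zero
  unfold divergence
  fun_prop

theorem hasCompactSupport_divergence {φ : EuclideanSpace ℝ (Fin n) → EuclideanSpace ℝ (Fin n)}
    (hφ : HasCompactSupport φ) : HasCompactSupport (divergence φ) := by
  refine (hφ.fderiv (𝕜 := ℝ)).mono' (fun x hx => subset_tsupport _ ?_)
  rw [Function.mem_support] at hx ⊢
  contrapose! hx
  simp [divergence, hx]

/-- Pairing with the divergence of a test field is a continuous linear functional on `L²(Ω)`. -/
theorem exists_pairing {φ : EuclideanSpace ℝ (Fin n) → EuclideanSpace ℝ (Fin n)}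
    (hφ : φ ∈ testFields Ω) :
    ∃ ℓ : L2 Ω →L[ℝ] ℝ, ∀ u : L2 Ω, ∫ x in Ω, u x * divergence φ x = ℓ u := by
  have hm : MemLp (divergence φ) 2
      ((volume : Measure (EuclideanSpace ℝ (Fin n))).restrict Ω) :=
    (continuous_divergence hφ.1).memLp_of_hasCompactSupport (hasCompactSupport_divergence hφ.2.1)
  refine ⟨innerSL ℝ (hm.toLp _ : L2 Ω), fun u => ?_⟩
  rw [innerSL_apply_apply, L2.inner_def]
  refine integral_congr_ae ?_
  filter_upwards [hm.coeFn_toLp] with x hx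
  simp [hx]

theorem zero_mem_testFields : (0 : EuclideanSpace ℝ (Fin n) → EuclideanSpace ℝ (Fin n)) ∈
    testFields Ω := by
  refine ⟨contDiff_const, HasCompactSupport.zero, ?_, fun x => by simp⟩
  simp

theorem totalVariation_nonneg (u : L2 Ω) : 0 ≤ totalVariation Ω u := by
  refine le_trans (le_of_eq ?_) (le_iSup₂ (0 : EuclideanSpace ℝ (Fin n) → _) zero_mem_testFields)
  simp [divergence]

theorem half_norm_sq_le_J (u : L2 Ω) : ((1 / 2 * ‖u‖ ^ 2 : ℝ) : EReal) ≤ J Ω u :=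
  le_add_of_nonneg_right (totalVariation_nonneg u)

theorem J_ne_bot (u : L2 Ω) : J Ω u ≠ ⊥ :=
  ((EReal.bot_lt_coe _).trans_le (half_norm_sq_le_J u)).ne'

theorem exists_J_eq_coe {u : L2 Ω} (hu : u ∈ domJ Ω) : ∃ r : ℝ, J Ω u = r :=
  ⟨(J Ω u).toReal, (EReal.coe_toReal (ne_of_lt hu) (J_ne_bot u)).symm⟩

theorem J_le_coe_iff (u : L2 Ω) (c : ℝ) :
    J Ω u ≤ c ↔
      ∀ φ ∈ testFields Ω, 1 / 2 * ‖u‖ ^ 2 + ∫ x in Ω, u x * divergence φ x ≤ c := by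
  have h1 : J Ω u ≤ c ↔ totalVariation Ω u ≤ ((c - 1 / 2 * ‖u‖ ^ 2 : ℝ) : EReal) := by
    rw [J, EReal.coe_sub, add_comm]
    exact (EReal.le_sub_iff_add_le (Or.inl (EReal.coe_ne_bot _))
      (Or.inl (EReal.coe_ne_top _))).symm
  rw [h1, totalVariation, iSup₂_le_iff]
  refine forall₂_congr fun φ _ => ?_
  rw [EReal.coe_le_coe_iff, le_sub_iff_add_le']

theorem J_segment_le {w v : L2 Ω} {r s : ℝ} (hw : J Ω w ≤ r) (hv : J Ω v ≤ s) {t : ℝ}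
    (ht0 : 0 ≤ t) (ht1 : t ≤ 1) :
    J Ω (w + t • (v - w)) ≤ ((r + t * (s - r) : ℝ) : EReal) := by
  rw [J_le_coe_iff] at *
  intro φ hφ
  obtain ⟨ℓ, hℓ⟩ := exists_pairing hφ
  have h1 := hw φ hφ
  have h2 := hv φ hφ
  rw [hℓ] at h1 h2 ⊢
  have h3 : ‖w + t • (v - w)‖ ^ 2
      = (1 - t) * ‖w‖ ^ 2 + t * ‖v‖ ^ 2 - t * (1 - t) * ‖v - w‖ ^ 2 := by
    rw [norm_add_sq_real, norm_smul, mul_pow, norm_sub_sq_real, inner_smul_right, inner_sub_right,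
      real_inner_self_eq_norm_sq, real_inner_comm v w, Real.norm_eq_abs, sq_abs]
    ring
  have h4 : 0 ≤ t * (1 - t) * ‖v - w‖ ^ 2 :=
    mul_nonneg (mul_nonneg ht0 (by linarith)) (sq_nonneg _)
  rw [h3, map_add, map_smul, map_sub, smul_eq_mul]
  nlinarith [mul_le_mul_of_nonneg_left h1 (sub_nonneg.2 ht1), mul_le_mul_of_nonneg_left h2 ht0]

/-! ### The step functional -/

variable {H : Type*} [NormedAddCommGroup H] {D : Set (L2 Ω)} {F : L2 Ω → H} {yδ : H} {a : ℝ}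
  {u ξ w : L2 Ω}

theorem stepFunctional_eq_coe {r s : ℝ} (hu : J Ω u = s) (hw : J Ω w = r) :
    stepFunctional Ω F yδ a u ξ w
      = ((1 / 2 * ‖F w - yδ‖ ^ 2 + a * (r - s - inner ℝ ξ (w - u)) : ℝ) : EReal) := by
  rw [stepFunctional, bregman, hu, hw]
  norm_cast

theorem stepFunctional_eq_top (ha : 0 < a) (hu : u ∈ domJ Ω) (hw : w ∉ domJ Ω) :
    stepFunctional Ω F yδ a u ξ w = ⊤ := by
  obtain ⟨s, hs⟩ := exists_J_eq_coe hu
  have hw' : J Ω w = ⊤ := by simpa [domJ] using hw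
  rw [stepFunctional, bregman, hs, hw', EReal.top_sub_coe, EReal.top_sub_coe,
    EReal.coe_mul_top_of_pos ha, EReal.coe_add_top]

theorem IsStepMinimizer.mem_domJ (ha : 0 < a) (hu : u ∈ D ∩ domJ Ω)
    (hw : IsStepMinimizer Ω D F yδ a u ξ w) : w ∈ domJ Ω := by
  by_contra h
  obtain ⟨s, hs⟩ := exists_J_eq_coe hu.2
  have h1 := isMinOn_iff.1 hw.2 u hu.1
  rw [stepFunctional_eq_top ha hu.2 h, stepFunctional_eq_coe hs hs, top_le_iff] at h1
  exact EReal.coe_ne_top _ h1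

/-- Completing the square in `J w - ⟨ξ, w⟩ ≥ ½ ‖w‖² - ⟨ξ, w⟩` shows that the Bregman
distance is coercive in `w`. -/
theorem bregman_lower_bound {r s : ℝ} (hw : J Ω w = r) :
    1 / 2 * ‖w - ξ‖ ^ 2 - (1 / 2 * ‖ξ‖ ^ 2 + s - inner ℝ ξ u) ≤ r - s - inner ℝ ξ (w - u) := by
  have h1 := half_norm_sq_le_J w
  rw [hw, EReal.coe_le_coe_iff] at h1
  rw [norm_sub_sq_real, inner_sub_right, real_inner_comm]
  linarith

/-! ### Existence of minimizers -/

variable [InnerProductSpace ℝ H] {F' : L2 Ω → (L2 Ω →L[ℝ] H)}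

/-- Weak lower semicontinuity of the step functional along a sequence whose images under `F`
converge weakly as well. -/
theorem stepFunctional_le_of_weaklyTendsto (ha : 0 < a) {s : ℝ} (hu : J Ω u = s) {x : ℕ → L2 Ω}
    (hx : WeaklyTendsto x w) (hFx : WeaklyTendsto (fun m => F (x m)) (F w)) {c : ℕ → ℝ} {I : ℝ}
    (hc : Tendsto c atTop (𝓝 I)) (hle : ∀ m, stepFunctional Ω F yδ a u ξ (x m) ≤ c m) :
    stepFunctional Ω F yδ a u ξ w ≤ I := by
  have hud : u ∈ domJ Ω := by simp [domJ, hu]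
  have key : J Ω w ≤ (((I - 1 / 2 * ‖F w - yδ‖ ^ 2) / a + s + inner ℝ ξ (w - u) : ℝ) : EReal) := by
    rw [J_le_coe_iff]
    intro φ hφ
    obtain ⟨ℓ, hℓ⟩ := exists_pairing hφ
    -- Every term is bounded below by a weakly continuous affine function, exact in the limit.
    have hlower : ∀ m, (1 / 2 * ‖F w - yδ‖ ^ 2 + inner ℝ (F w - yδ) (F (x m) - F w))
        + a * ((1 / 2 * ‖w‖ ^ 2 + inner ℝ w (x m - w)) + ℓ (x m) - s
          - (inner ℝ ξ (x m - w) + inner ℝ ξ (w - u))) ≤ c m := by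
      intro m
      have hxm : x m ∈ domJ Ω := by
        by_contra h
        have h1 := hle m
        rw [stepFunctional_eq_top ha hud h, top_le_iff] at h1
        exact EReal.coe_ne_top _ h1
      obtain ⟨r, hr⟩ := exists_J_eq_coe hxm
      have h1 := hle m
      rw [stepFunctional_eq_coe hu hr, EReal.coe_le_coe_iff] at h1
      have h2 := (J_le_coe_iff (x m) r).1 hr.le φ hφ
      rw [hℓ] at h2
      have h3 := half_norm_sub_sq_ge (x m) w 0
      simp only [sub_zero] at h3
      have h4 := half_norm_sub_sq_ge (F (x m)) (F w) yδ
      have h5 : inner ℝ ξ (x m - u) = inner ℝ ξ (x m - w) + inner ℝ ξ (w - u) := by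
        rw [← inner_add_right, sub_add_sub_cancel]
      rw [h5] at h1
      have h6 := mul_le_mul_of_nonneg_left (show
        (1 / 2 * ‖w‖ ^ 2 + inner ℝ w (x m - w)) + ℓ (x m) - s
          - (inner ℝ ξ (x m - w) + inner ℝ ξ (w - u))
          ≤ r - s - (inner ℝ ξ (x m - w) + inner ℝ ξ (w - u)) by linarith) ha.le
      linarith
    have hlim : Tendsto (fun m => (1 / 2 * ‖F w - yδ‖ ^ 2 + inner ℝ (F w - yδ) (F (x m) - F w))
        + a * ((1 / 2 * ‖w‖ ^ 2 + inner ℝ w (x m - w)) + ℓ (x m) - s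
          - (inner ℝ ξ (x m - w) + inner ℝ ξ (w - u)))) atTop
        (𝓝 ((1 / 2 * ‖F w - yδ‖ ^ 2 + 0)
        + a * ((1 / 2 * ‖w‖ ^ 2 + 0) + ℓ w - s - (0 + inner ℝ ξ (w - u))))) :=
      ((hFx.inner_sub _).const_add _).add ((((((hx.inner_sub w).const_add _).add
        (hx ℓ)).sub_const s).sub ((hx.inner_sub ξ).add_const _)).const_mul a)
    have h1 := le_of_tendsto_of_tendsto' hlim hc hlower
    have h2 : 1 / 2 * ‖w‖ ^ 2 + ℓ w - s - inner ℝ ξ (w - u)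
        ≤ (I - 1 / 2 * ‖F w - yδ‖ ^ 2) / a := by
      rw [le_div_iff₀ ha]
      linarith
    rw [hℓ]
    linarith
  obtain ⟨r, hr⟩ := exists_J_eq_coe (key.trans_lt (EReal.coe_lt_top _))
  rw [hr, EReal.coe_le_coe_iff] at key
  rw [stepFunctional_eq_coe hu hr, EReal.coe_le_coe_iff]
  have h : r - s - inner ℝ ξ (w - u) ≤ (I - 1 / 2 * ‖F w - yδ‖ ^ 2) / a := by linarith
  rw [le_div_iff₀ ha] at h
  linarith

theorem exists_isStepMinimizer [CompleteSpace H] (hF : WeaklySeqClosed D F) (ha : 0 < a)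
    (hu : u ∈ D ∩ domJ Ω) : ∃ w, IsStepMinimizer Ω D F yδ a u ξ w := by
  obtain ⟨s, hs⟩ := exists_J_eq_coe hu.2
  let T : L2 Ω → EReal := stepFunctional Ω F yδ a u ξ
  let B : ℝ := a * (1 / 2 * ‖ξ‖ ^ 2 + s - inner ℝ ξ u)
  have hbound : ∀ (v : L2 Ω) (c : ℝ), T v ≤ c →
      1 / 2 * ‖F v - yδ‖ ^ 2 + a * (1 / 2 * ‖v - ξ‖ ^ 2) ≤ c + B := by
    intro v c hvc
    have hv : v ∈ domJ Ω := by
      by_contra h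
      rw [show T v = ⊤ from stepFunctional_eq_top ha hu.2 h, top_le_iff] at hvc
      exact EReal.coe_ne_top _ hvc
    obtain ⟨r, hr⟩ := exists_J_eq_coe hv
    rw [show T v = _ from stepFunctional_eq_coe hs hr, EReal.coe_le_coe_iff] at hvc
    have h1 := mul_le_mul_of_nonneg_left (bregman_lower_bound (ξ := ξ) (u := u) (s := s) hr) ha.le
    rw [mul_sub] at h1
    change _ ≤ c + a * _
    linarith
  -- The real values of `T` on `D ∩ dom J`, with infimum `I`.
  let V : Set ℝ := {c | ∃ v ∈ D, T v = c}
  have hVne : V.Nonempty := ⟨_, u, hu.1, stepFunctional_eq_coe hs hs⟩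
  have hVbdd : BddBelow V := by
    refine ⟨-B, ?_⟩
    rintro c ⟨v, -, hv⟩
    have h := hbound v c hv.le
    have : 0 ≤ 1 / 2 * ‖F v - yδ‖ ^ 2 + a * (1 / 2 * ‖v - ξ‖ ^ 2) := by positivity
    linarith
  let I : ℝ := sInf V
  have hmin : ∀ m : ℕ, ∃ v ∈ D, T v ≤ ((I + 1 / ((m : ℝ) + 1) : ℝ) : EReal) := by
    intro m
    obtain ⟨c, ⟨v, hvD, hv⟩, hc⟩ := Real.lt_sInf_add_pos hVne
      (show (0 : ℝ) < 1 / ((m : ℝ) + 1) by positivity)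
    exact ⟨v, hvD, by rw [hv]; exact EReal.coe_le_coe hc.le⟩
  choose x hxD hx using hmin
  have hx1 : ∀ m, 1 / 2 * ‖F (x m) - yδ‖ ^ 2 + a * (1 / 2 * ‖x m - ξ‖ ^ 2) ≤ I + 1 + B := by
    intro m
    refine (hbound _ _ (hx m)).trans ?_
    have : 1 / ((m : ℝ) + 1) ≤ 1 := by
      rw [div_le_one (by positivity)]
      linarith [m.cast_nonneg (α := ℝ)]
    linarith
  have hxb : ∀ m, ‖x m‖ ≤ √(2 * ((I + 1 + B) / a)) + ‖ξ‖ := by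
    intro m
    have h1 : ‖x m - ξ‖ ≤ √(2 * ((I + 1 + B) / a)) := by
      refine Real.le_sqrt_of_sq_le ?_
      have h2 : 1 / 2 * ‖x m - ξ‖ ^ 2 ≤ (I + 1 + B) / a := by
        rw [le_div_iff₀ ha]
        nlinarith [hx1 m, sq_nonneg ‖F (x m) - yδ‖]
      linarith
    linarith [norm_le_norm_sub_add (x m) ξ]
  have hFb : ∀ m, ‖F (x m)‖ ≤ √(2 * (I + 1 + B)) + ‖yδ‖ := by
    intro m
    have h1 : ‖F (x m) - yδ‖ ≤ √(2 * (I + 1 + B)) := by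
      refine Real.le_sqrt_of_sq_le ?_
      have : 0 ≤ a * (1 / 2 * ‖x m - ξ‖ ^ 2) := by positivity
      linarith [hx1 m]
    linarith [norm_le_norm_sub_add (F (x m)) yδ]
  obtain ⟨w, φ, hφ, hw⟩ := exists_weaklyTendsto_subseq x _ hxb
  obtain ⟨z, ψ, hψ, hz⟩ := exists_weaklyTendsto_subseq (fun m => F (x (φ m))) _ fun m => hFb (φ m)
  have hw' := hw.comp hψ
  obtain ⟨hwD, hFw⟩ := hF (fun m => x (φ (ψ m))) w z (fun m => hxD _) hw' hz
  rw [← hFw] at hz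
  have hc : Tendsto (fun m => I + 1 / (((φ (ψ m) : ℕ) : ℝ) + 1)) atTop (𝓝 I) := by
    simpa using ((tendsto_one_div_add_atTop_nhds_zero_nat (𝕜 := ℝ)).comp
      (hφ.comp hψ).tendsto_atTop).const_add I
  have hTw : T w ≤ I :=
    stepFunctional_le_of_weaklyTendsto ha hs hw' hz hc fun m => hx (φ (ψ m))
  refine ⟨w, hwD, isMinOn_iff.2 fun v hv => ?_⟩
  by_cases hvd : v ∈ domJ Ω
  · obtain ⟨r, hr⟩ := exists_J_eq_coe hvd
    have hTv := stepFunctional_eq_coe (F := F) (yδ := yδ) (a := a) (ξ := ξ) hs hr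
    rw [hTv]
    exact hTw.trans (EReal.coe_le_coe (csInf_le hVbdd ⟨v, hv, hTv⟩))
  · rw [stepFunctional_eq_top ha hu.2 hvd]
    exact le_top

/-! ### Optimality condition -/

/-- The variational inequality of a minimizer, `0 ≤ ⟨F w - y^δ, F'(w) (v - w)⟩ +
a (J v - J w - ⟨ξ, v - w⟩)`. -/
theorem IsStepMinimizer.variational_ineq (hD : Convex ℝ D) (ha : 0 < a) (hu : u ∈ D ∩ domJ Ω)
    (hw : IsStepMinimizer Ω D F yδ a u ξ w) (hd : HasFDerivWithinAt F (F' w) D w) {v : L2 Ω}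
    (hv : v ∈ D) {r q : ℝ} (hr : J Ω w = r) (hq : J Ω v = q) :
    0 ≤ inner ℝ (F w - yδ) (F' w (v - w)) + a * (q - r - inner ℝ ξ (v - w)) := by
  obtain ⟨s, hs⟩ := exists_J_eq_coe hu.2
  let p : ℝ → L2 Ω := fun t => w + t • (v - w)
  have hpD : Set.MapsTo p (Set.Icc 0 1) D := fun t ht => hD.add_smul_sub_mem hw.1 hv ht
  have hp0 : p 0 = w := by simp [p]
  have hp : HasDerivWithinAt p (v - w) (Set.Icc 0 1) 0 := by
    have h := ((hasDerivWithinAt_id (0 : ℝ) (Set.Icc 0 1)).smul_const (v - w)).const_add w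
    rwa [one_smul] at h
  have hFp : HasDerivWithinAt (fun t => F (p t)) (F' w (v - w)) (Set.Icc 0 1) 0 :=
    hd.comp_hasDerivWithinAt_of_eq 0 hp hpD hp0.symm
  let b : ℝ := a * (q - r - inner ℝ ξ (v - w))
  let G : ℝ → ℝ := fun t => 1 / 2 * ‖F (p t) - yδ‖ ^ 2 + t * b
  have hG : HasDerivWithinAt G (inner ℝ (F w - yδ) (F' w (v - w)) + b) (Set.Icc 0 1) 0 := by
    have h := (((hFp.sub_const yδ).norm_sq).const_mul (1 / 2)).add
      ((hasDerivWithinAt_id (0 : ℝ) (Set.Icc 0 1)).mul_const b)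
    rw [hp0] at h
    refine h.congr_deriv ?_
    ring
  have hGmin : IsMinOn G (Set.Icc 0 1) 0 := by
    refine isMinOn_iff.2 fun t ht => ?_
    have hJ := J_segment_le hr.le hq.le ht.1 ht.2
    obtain ⟨c, hc⟩ := exists_J_eq_coe (u := p t) (hJ.trans_lt (EReal.coe_lt_top _))
    have hc' : c ≤ r + t * (q - r) := by
      rw [← EReal.coe_le_coe_iff, ← hc]
      exact hJ
    have h := isMinOn_iff.1 hw.2 (p t) (hpD ht)
    rw [stepFunctional_eq_coe hs hr, stepFunctional_eq_coe hs hc, EReal.coe_le_coe_iff] at h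
    have h1 : inner ℝ ξ (p t - u) = inner ℝ ξ (w - u) + t * inner ℝ ξ (v - w) := by
      rw [← real_inner_smul_right, ← inner_add_right]
      congr 1
      simp only [p]
      abel
    rw [h1] at h
    have h2 := mul_le_mul_of_nonneg_left hc' ha.le
    simp only [G, b, hp0]
    nlinarith
  have h := hGmin.localize.hasFDerivWithinAt_nonneg hG.hasFDerivWithinAt (y := 1)
    (mem_posTangentConeAt_of_segment_subset (by simp [segment_eq_Icc]))
  simpa using h

theorem subgradientUpdate_mem_subdifferentialOn [CompleteSpace H] (hD : Convex ℝ D) (ha : 0 < a)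
    (hu : u ∈ D ∩ domJ Ω) (hw : IsStepMinimizer Ω D F yδ a u ξ w)
    (hd : HasFDerivWithinAt F (F' w) D w) :
    subgradientUpdate Ω F F' yδ a ξ w ∈ subdifferentialOn Ω D w := by
  have hwd := hw.mem_domJ ha hu
  refine ⟨hw.1, hwd, fun v hv => ?_⟩
  by_cases hvd : v ∈ domJ Ω
  · obtain ⟨r, hr⟩ := exists_J_eq_coe hwd
    obtain ⟨q, hq⟩ := exists_J_eq_coe hvd
    have h := hw.variational_ineq hD ha hu hd hv hr hq
    rw [hr, hq, ← EReal.coe_add, EReal.coe_le_coe_iff, subgradientUpdate, inner_sub_left,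
      real_inner_smul_left, ContinuousLinearMap.adjoint_inner_left]
    have h1 : -(1 / a * inner ℝ (F w - yδ) (F' w (v - w))) ≤ q - r - inner ℝ ξ (v - w) := by
      rw [one_div, neg_le_iff_add_nonneg, ← mul_nonneg_iff_of_pos_left ha, mul_add,
        mul_inv_cancel_left₀ ha.ne']
      linarith
    linarith
  · have hv' : J Ω v = ⊤ := by simpa [domJ] using hvd
    rw [hv']
    exact le_top

/-- At an interior point of `D` a subgradient of `J` on `D` is a subgradient on the whole space:
the segment from `w` to any `v` starts inside `D`, and `J` is convex along it. -/
theorem mem_subdifferential_of_mem_interior (hξ : ξ ∈ subdifferentialOn Ω D w)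
    (hw : w ∈ interior D) : ξ ∈ subdifferential Ω w := by
  refine ⟨hξ.2.1, fun v => ?_⟩
  by_cases hvd : v ∈ domJ Ω
  · obtain ⟨r, hr⟩ := exists_J_eq_coe hξ.2.1
    obtain ⟨q, hq⟩ := exists_J_eq_coe hvd
    have hp : Tendsto (fun t : ℝ => w + t • (v - w)) (𝓝[>] 0) (𝓝 w) := by
      have : Continuous fun t : ℝ => w + t • (v - w) := by fun_prop
      simpa using (this.tendsto 0).mono_left nhdsWithin_le_nhds
    obtain ⟨t, htD, ht⟩ := ((hp.eventually (mem_interior_iff_mem_nhds.1 hw)).and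
      (Ioc_mem_nhdsGT (zero_lt_one (α := ℝ)))).exists
    have h := (hξ.2.2 _ htD).trans (J_segment_le hr.le hq.le ht.1.le ht.2)
    rw [hr, ← EReal.coe_add, EReal.coe_le_coe_iff, add_sub_cancel_left,
      real_inner_smul_right] at h
    have h1 := le_of_mul_le_mul_left (show t * inner ℝ ξ (v - w) ≤ t * (q - r) by linarith) ht.1
    rw [hr, hq, ← EReal.coe_add, EReal.coe_le_coe_iff]
    linarith
  · have hv' : J Ω v = ⊤ := by simpa [domJ] using hvd
    rw [hv']
    exact le_top

/-- Every iterate has finite `J`, since it competes with its predecessor. -/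
theorem AreIterates.mem [CompleteSpace H] {α : ℕ → ℝ} (hα : ∀ j, 0 < α j) {u ξ : ℕ → L2 Ω} {k : ℕ}
    (h : AreIterates Ω D F F' yδ α u ξ k) : ∀ j ≤ k, u j ∈ D ∩ domJ Ω
  | 0, _ => h.init_mem
  | j + 1, hj =>
    ⟨(h.minimizer j hj).1, (h.minimizer j hj).mem_domJ (hα j) (h.mem hα j (Nat.le_of_succ_le hj))⟩

end BregmanTikhonov

theorem mainTheorem12 {n : ℕ} (Ω : Set (EuclideanSpace ℝ (Fin n))) (hΩ : IsOpen Ω)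
    {H : Type*} [NormedAddCommGroup H] [InnerProductSpace ℝ H] [CompleteSpace H]
    (D : Set (BregmanTikhonov.L2 Ω)) (F : BregmanTikhonov.L2 Ω → H)
    (F' : BregmanTikhonov.L2 Ω → (BregmanTikhonov.L2 Ω →L[ℝ] H))
    (y : H) (ubar : BregmanTikhonov.L2 Ω) (η ρ : ℝ)
    (hF : BregmanTikhonov.OperatorAssumption Ω D F F' y ubar η ρ)
    (yδ : H) (α : ℕ → ℝ) (hα : ∀ j, 0 < α j)
    (u ξ : ℕ → BregmanTikhonov.L2 Ω) (k : ℕ)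
    (hit : BregmanTikhonov.AreIterates Ω D F F' yδ α u ξ k) :
    (∃ w, BregmanTikhonov.IsStepMinimizer Ω D F yδ (α k) (u k) (ξ k) w) ∧
      ∀ w, BregmanTikhonov.IsStepMinimizer Ω D F yδ (α k) (u k) (ξ k) w →
        BregmanTikhonov.subgradientUpdate Ω F F' yδ (α k) (ξ k) w
            ∈ BregmanTikhonov.subdifferentialOn Ω D w ∧
          (w ∈ interior D →
            BregmanTikhonov.subgradientUpdate Ω F F' yδ (α k) (ξ k) w
              ∈ BregmanTikhonov.subdifferential Ω w) := by
  have hu := hit.mem hα k le_rfl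
  refine ⟨BregmanTikhonov.exists_isStepMinimizer hF.weaklySeqClosed (hα k) hu, fun w hw => ?_⟩
  have h := BregmanTikhonov.subgradientUpdate_mem_subdifferentialOn hF.convex_domain (hα k) hu hw
    (hF.differentiable w hw.1)
  exact ⟨h, BregmanTikhonov.mem_subdifferential_of_mem_interior h⟩
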